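/- Let $F$ be a (real or complex) Banach space with a finite-dimensional decomposition (F.D.D.) $(F_i)_{i\in\mathbb N}$: the $F_i$ are finite-dimensional subspaces and every $x\in F$ is uniquely a norm-convergent series $x=\sum_i f_i$ with $f_i\in F_i$. For a nonempty finite interval $I\subseteq\mathbb N$ let $P_I x=\sum_{i\in I}f_i$, and let $K=\sup_n\|P_{[0,n]}\|$ be the constant of the decomposition. Let $E\subseteq F$ be a closed infinite-dimensional subspace with unit sphere $S_E$, and let $\Delta=(\delta_i)_{i\ge 0}$ be a decreasing sequence of positive reals converging to $0$. A sequence $(x_i)$ in $S_E$ is a $\Delta$-block with witness $(I_i)$ if $I_0<I_1<\cdots$ are nonempty intervals with $\|P_{I_i}x_i-x_i\|<\delta_i$ for all $i$. For a strictly increasing sequence $(m_i)$ of natural numbers, $R_\Delta(m_i,x_i)$ means that $(x_i)$ is a $\Delta$-block with a witness $(I_i)$ such that $m_0<I_0$ and for every $i$ there is $j$ with $I_i<m_j<m_{j+1}<I_{i+1}$. A $\Delta$-block tree is a nonempty set $T$ of finite strings in $S_E$, closed under initial segments, such that for every $(x_0,\dots,x_{n-1})\in T$ the set $\{y:(x_0,\dots,x_{n-1},y)\in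 T\}$ can be written as $\{y_i\}_{i\ge 0}$, where there are nonempty intervals $I_i\subseteq\mathbb N$ with $\|y_i-P_{I_i}y_i\|<\delta_n$ for all $i$ and $\min I_i\to\infty$. A branch of $T$ is an infinite sequence all of whose finite initial segments belong to $T$. For sequences $(x_i)$, $(y_i)$ in Banach spaces write $(x_i)\le^C(y_i)$ if $\|\sum_{i<n}a_ix_i\|\le C\|\sum_{i<n}a_iy_i\|$ for all $n$ and all scalars $a_i$; $(x_i)\ge^C(y_i)$ if $(y_i)\le^C(x_i)$; and $(x_i)\approx^C(y_i)$ if both hold. Write $\le,\ge,\approx$ if this is so for some $C$. Let $\mathcal A$ be a countable set of normalised Schauder bases of Banach spaces. (1) If every $\Delta$-block tree has a branch $(x_i)$ with $(x_i)\le(e_i)$ for some $(e_i)\in\mathcal A$, then there are a constant $C$, some $(e_i)\in\mathcal A$ and a strictly increasing sequence $(m_i)$ such that every $\Delta$-block $(x_i)$ in $E$ with $R_\Delta(m_i,x_i)$ satisfies $(x_i)\le^C(e_i)$. (2) If $\Delta$ is small relative to $K$, in the sense that $\sum_i\delta_i<\frac1{2K+1}$, then the same implication holds with $\ge$ and $\ge^C$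 in place of $\le$ and $\le^C$, and with $\approx$ and $\approx^C$ in place of $\le$ and $\le^C$. -/

import Mathlib

open Filter Topology

namespace AsymptoticGames

section

variable {𝕜 : Type*} [RCLike 𝕜] {F : Type*} [NormedAddCommGroup F] [NormedSpace 𝕜 F]

/-- `(S i)` is a finite-dimensional decomposition of `F`: every `S i` is a finite-dimensional
subspace and every `x` is in a unique way the norm limit of the partial sums of a series
`∑ i, f i` with `f i ∈ S i`. -/
structure IsFDD (S : ℕ → Submodule 𝕜 F) : Prop where
  finiteDimensional : ∀ i, FiniteDimensional 𝕜 (S i)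
  existsUnique_expansion : ∀ x : F, ∃! f : ℕ → F,
    (∀ i, f i ∈ S i) ∧ Tendsto (fun n => ∑ i ∈ Finset.range n, f i) atTop (𝓝 x)

/-- The `i`-th term of the expansion of `x`. -/
noncomputable def IsFDD.coord {S : ℕ → Submodule 𝕜 F} (hS : IsFDD S) (x : F) (i : ℕ) : F :=
  (hS.existsUnique_expansion x).choose i

/-- The projection `P_I x`, where `I = {a, a + 1, …, b}`. -/
noncomputable def IsFDD.proj {S : ℕ → Submodule 𝕜 F} (hS : IsFDD S) (a b : ℕ) (x : F) : F :=
  ∑ i ∈ Finset.Icc a b, hS.coord x i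

/-- `K` bounds the norms of all initial projections `x ↦ ∑_{i ≤ n} f i`; the least such `K` is the
constant of the decomposition. -/
def IsFDD.ConstantLE {S : ℕ → Submodule 𝕜 F} (hS : IsFDD S) (K : ℝ) : Prop :=
  ∀ (n : ℕ) (x : F), ‖hS.proj 0 n x‖ ≤ K * ‖x‖

/-- `Δ > 0`: a decreasing sequence of positive reals converging to `0`. -/
structure IsPosNull (δ : ℕ → ℝ) : Prop where
  antitone : Antitone δ
  pos : ∀ i, 0 < δ i
  tendsto_zero : Tendsto δ atTop (𝓝 0)

/-- All vectors of the sequence `x` lie in the unit sphere of `E`. -/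
def InSphere (E : Submodule 𝕜 F) (x : ℕ → F) : Prop :=
  ∀ i, x i ∈ E ∧ ‖x i‖ = 1

/-- The nonempty intervals `I i = [a i, b i]` satisfy `I 0 < I 1 < ⋯` and witness that `x` is a
`Δ`-block. -/
structure IsBlockWitness {S : ℕ → Submodule 𝕜 F} (hS : IsFDD S) (δ : ℕ → ℝ) (x : ℕ → F)
    (a b : ℕ → ℕ) : Prop where
  nonempty : ∀ i, a i ≤ b i
  lt : ∀ i, b i < a (i + 1)
  close : ∀ i, ‖hS.proj (a i) (b i) (x i) - x i‖ < δ i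

/-- `x` is an infinite `Δ`-block in `E`, that is, `x ∈ bb_{E,Δ}(S)`. -/
def IsBlock {S : ℕ → Submodule 𝕜 F} (hS : IsFDD S) (E : Submodule 𝕜 F) (δ : ℕ → ℝ)
    (x : ℕ → F) : Prop :=
  InSphere E x ∧ ∃ a b : ℕ → ℕ, IsBlockWitness hS δ x a b

/-- The relation `R(m_i, I_i)` for the intervals `I i = [a i, b i]`:
`m_0 < I_0`, and for every `i` there is `j` with `I_i < m_j < m_{j+1} < I_{i+1}`. -/
def SeparatedBy (m a b : ℕ → ℕ) : Prop :=
  m 0 < a 0 ∧ ∀ i, ∃ j, b i < m j ∧ m (j + 1) < a (i + 1)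

/-- The relation `R_Δ(m_i, x_i)`: `x` is a `Δ`-block with a witness `(I_i)` such that
`R(m_i, I_i)`. -/
def BlockSeparatedBy {S : ℕ → Submodule 𝕜 F} (hS : IsFDD S) (δ : ℕ → ℝ) (m : ℕ → ℕ)
    (x : ℕ → F) : Prop :=
  ∃ a b : ℕ → ℕ, IsBlockWitness hS δ x a b ∧ SeparatedBy m a b

/-- A `Δ`-block tree: a nonempty set of finite strings in the unit sphere of `E`, closed under
initial segments, such that the successors of every string of length `n` can be listed as
`{y 0, y 1, …}` with `‖y i - P_{I i} (y i)‖ < δ n` for intervals `I i` with `min (I i) → ∞`. -/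
structure IsBlockTree {S : ℕ → Submodule 𝕜 F} (hS : IsFDD S) (E : Submodule 𝕜 F) (δ : ℕ → ℝ)
    (T : Set (List F)) : Prop where
  nonempty : T.Nonempty
  mem_sphere : ∀ l ∈ T, ∀ v ∈ l, v ∈ E ∧ ‖v‖ = 1
  closed : ∀ l ∈ T, ∀ l', l' <+: l → l' ∈ T
  successors : ∀ l ∈ T, ∃ (y : ℕ → F) (a b : ℕ → ℕ),
    {v : F | l ++ [v] ∈ T} = Set.range y ∧
    (∀ i, a i ≤ b i) ∧
    (∀ i, ‖y i - hS.proj (a i) (b i) (y i)‖ < δ l.length) ∧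
    Tendsto a atTop atTop

/-- `x` is an infinite branch of `T`. -/
def IsBranch (T : Set (List F)) (x : ℕ → F) : Prop :=
  ∀ n, (List.range n).map x ∈ T

variable (𝕜) in
/-- `(x_i) ≤^C (y_i)`: `(y_i)` dominates (majorises) `(x_i)` with constant `C`. -/
def DominatedWith {X Y : Type*} [NormedAddCommGroup X] [NormedSpace 𝕜 X]
    [NormedAddCommGroup Y] [NormedSpace 𝕜 Y] (C : ℝ) (x : ℕ → X) (y : ℕ → Y) : Prop :=
  ∀ (c : ℕ → 𝕜) (n : ℕ),
    ‖∑ i ∈ Finset.range n, c i • x i‖ ≤ C * ‖∑ i ∈ Finset.range n, c i • y i‖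

variable (𝕜) in
/-- `(x_i) ≤ (y_i)`. -/
def Dominated {X Y : Type*} [NormedAddCommGroup X] [NormedSpace 𝕜 X]
    [NormedAddCommGroup Y] [NormedSpace 𝕜 Y] (x : ℕ → X) (y : ℕ → Y) : Prop :=
  ∃ C : ℝ, DominatedWith 𝕜 C x y

end

end AsymptoticGames

/-! Consider the game in which the first player names numbers n and the second answers with vectors
of the sphere of E nearly supported on an interval beyond n. The plays according to a strategy of
the second player form a Δ-block tree (`isBlockTree_strategyTree`). If the conclusion fails, the
second player has a strategy that defeats every basis with every constant C ∈ ℕ, and its tree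
contradicts the hypothesis. There are countably many pairs (basis, C), so it is enough to have
well-founded plans that defeat one pair from an arbitrary position; they are run one after another
(`exists_strategy`).

Such plans come from `forces_failure`. If defeat cannot be forced, the first player can avoid it
forever, and finite nets turn this avoidance into one sequence m: every block separated by m is
within 3δ_i of a play whose tail satisfies the estimate (`exists_separating`). The perturbation and
the head cost a multiple of ∑ δ_i|c_i|. If the dominating sequence controls this sum, all blocks
separated by m satisfy the estimate, a contradiction.

For lower estimates the dominating sequence is the block, and control follows from the smallness of
Δ (`IsBlockWitness.controlsWith`). For upper estimates it is the basis. A basis without control is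
defeated directly: multiples of order δ_i of one fixed vector, with phases matched to c_i, are added
to far vectors (`forces_upperFailure`). Hence (1) needs no smallness. -/

namespace AsymptoticGames

/-! ### Projections of a finite-dimensional decomposition and their uniform bound -/

section FDD

variable {𝕜 : Type*} [RCLike 𝕜] {F : Type*} [NormedAddCommGroup F] [NormedSpace 𝕜 F]
  {S : ℕ → Submodule 𝕜 F}

namespace IsFDD

lemma coord_mem (hS : IsFDD S) (x : F) (i : ℕ) : hS.coord x i ∈ S i :=
  (hS.existsUnique_expansion x).choose_spec.1.1 i

lemma tendsto_sum_coord (hS : IsFDD S) (x : F) :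
    Tendsto (fun n => ∑ i ∈ Finset.range n, hS.coord x i) atTop (𝓝 x) :=
  (hS.existsUnique_expansion x).choose_spec.1.2

lemma coord_eq_of_tendsto (hS : IsFDD S) {x : F} {f : ℕ → F} (hf : ∀ i, f i ∈ S i)
    (h : Tendsto (fun n => ∑ i ∈ Finset.range n, f i) atTop (𝓝 x)) : hS.coord x = f :=
  (hS.existsUnique_expansion x).unique ⟨hS.coord_mem x, hS.tendsto_sum_coord x⟩ ⟨hf, h⟩

lemma coord_add (hS : IsFDD S) (x y : F) : hS.coord (x + y) = hS.coord x + hS.coord y := by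
  refine hS.coord_eq_of_tendsto (fun i => (S i).add_mem (hS.coord_mem x i) (hS.coord_mem y i)) ?_
  simpa [Finset.sum_add_distrib] using (hS.tendsto_sum_coord x).add (hS.tendsto_sum_coord y)

lemma coord_smul (hS : IsFDD S) (c : 𝕜) (x : F) : hS.coord (c • x) = c • hS.coord x := by
  refine hS.coord_eq_of_tendsto (fun i => (S i).smul_mem c (hS.coord_mem x i)) ?_
  simpa [Finset.smul_sum] using (hS.tendsto_sum_coord x).const_smul c

/-- The projection `P_I` as a linear map. -/
noncomputable def projₗ (hS : IsFDD S) (a b : ℕ) : F →ₗ[𝕜] F where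
  toFun := hS.proj a b
  map_add' x y := by simp [proj, coord_add, Finset.sum_add_distrib]
  map_smul' c x := by simp [proj, coord_smul, Finset.smul_sum]

@[simp] lemma projₗ_apply (hS : IsFDD S) (a b : ℕ) (x : F) : hS.projₗ a b x = hS.proj a b x := rfl

lemma proj_mem_iSup (hS : IsFDD S) (a b : ℕ) (x : F) :
    hS.proj a b x ∈ ⨆ i ∈ Finset.Icc a b, S i :=
  Submodule.sum_mem _ fun i hi =>
    (le_iSup₂ (f := fun i (_ : i ∈ Finset.Icc a b) => S i) i hi) (hS.coord_mem x i)

lemma finiteDimensional_iSup (hS : IsFDD S) (a b : ℕ) :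
    FiniteDimensional 𝕜 (⨆ i ∈ Finset.Icc a b, S i : Submodule 𝕜 F) := by
  have := hS.finiteDimensional
  rw [← Finset.sup_eq_iSup]
  exact Submodule.finiteDimensional_finset_sup _ _

lemma coord_proj (hS : IsFDD S) (a b : ℕ) (x : F) :
    hS.coord (hS.proj a b x) = fun i => if i ∈ Finset.Icc a b then hS.coord x i else 0 := by
  refine hS.coord_eq_of_tendsto (fun i => ?_) ?_
  · split_ifs
    · exact hS.coord_mem x i
    · exact (S i).zero_mem
  · refine tendsto_const_nhds.congr' ?_
    filter_upwards [eventually_gt_atTop b] with n hn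
    rw [← Finset.sum_filter, proj]
    refine Finset.sum_congr ?_ fun _ _ => rfl
    ext i
    simp only [Finset.mem_Icc, Finset.mem_filter, Finset.mem_range]
    omega

lemma proj_proj_of_subset (hS : IsFDD S) {a b c d : ℕ} (x : F)
    (h : Finset.Icc a b ⊆ Finset.Icc c d) : hS.proj a b (hS.proj c d x) = hS.proj a b x := by
  conv_lhs => rw [proj, coord_proj]
  exact Finset.sum_congr rfl fun i hi => if_pos (h hi)

lemma proj_proj_of_disjoint (hS : IsFDD S) {a b c d : ℕ} (x : F)
    (h : Disjoint (Finset.Icc a b) (Finset.Icc c d)) : hS.proj a b (hS.proj c d x) = 0 := by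
  rw [proj, coord_proj]
  exact Finset.sum_eq_zero fun i hi => if_neg (Finset.disjoint_left.1 h hi)

lemma proj_zero_left (hS : IsFDD S) (n : ℕ) (x : F) :
    hS.proj 0 n x = ∑ i ∈ Finset.range (n + 1), hS.coord x i := by
  rw [proj]
  refine Finset.sum_congr ?_ fun _ _ => rfl
  ext i
  simp only [Finset.mem_Icc, Finset.mem_range]
  omega

lemma proj_zero_add_proj (hS : IsFDD S) {a b : ℕ} (hab : a ≤ b) (x : F) :
    hS.proj 0 a x + hS.proj (a + 1) b x = hS.proj 0 b x := by
  simp only [proj]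
  rw [← Finset.sum_union]
  · refine Finset.sum_congr ?_ fun _ _ => rfl
    ext i
    simp only [Finset.mem_Icc, Finset.mem_union]
    omega
  · rw [Finset.disjoint_left]
    intro i
    simp only [Finset.mem_Icc]
    omega

lemma tendsto_proj_zero (hS : IsFDD S) (x : F) :
    Tendsto (fun n => hS.proj 0 n x) atTop (𝓝 x) := by
  simp only [proj_zero_left]
  exact (hS.tendsto_sum_coord x).comp (tendsto_add_atTop_nat 1)

lemma ConstantLE.nonneg {hS : IsFDD S} {K : ℝ} (hK : hS.ConstantLE K) {x : F} (hx : x ≠ 0) :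
    0 ≤ K :=
  nonneg_of_mul_nonneg_left ((norm_nonneg _).trans (hK 0 x)) (norm_pos_iff.2 hx)

lemma ConstantLE.norm_proj_le {hS : IsFDD S} {K : ℝ} (hK : hS.ConstantLE K) (hK0 : 0 ≤ K)
    (a b : ℕ) (x : F) : ‖hS.proj a b x‖ ≤ 2 * K * ‖x‖ := by
  have h0 : 0 ≤ K * ‖x‖ := by positivity
  rcases lt_or_ge b a with hab | hab
  · rw [proj, Finset.Icc_eq_empty (by omega), Finset.sum_empty, norm_zero]
    positivity
  rcases Nat.eq_zero_or_pos a with rfl | ha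
  · linarith [hK b x]
  · have h := hS.proj_zero_add_proj (a := a - 1) (b := b) (by omega) x
    rw [Nat.sub_add_cancel ha] at h
    rw [← eq_sub_iff_add_eq'] at h
    rw [h]
    linarith [norm_sub_le (hS.proj 0 b x) (hS.proj 0 (a - 1) x), hK b x, hK (a - 1) x]

/-- The convergent sequences of partial sums of series `∑ i, f i` with `f i ∈ S i`, as a subspace
of the space of convergent sequences in `F`. -/
def partialSums (S : ℕ → Submodule 𝕜 F) : Submodule 𝕜 C(OnePoint ℕ, F) where
  carrier := {g | g ((0 : ℕ) : OnePoint ℕ) = 0 ∧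
    ∀ n : ℕ, g ((n + 1 : ℕ) : OnePoint ℕ) - g (n : OnePoint ℕ) ∈ S n}
  zero_mem' := ⟨rfl, fun n => by simp⟩
  add_mem' {f g} hf hg := ⟨by simp [hf.1, hg.1], fun n => by
    simpa [add_sub_add_comm] using (S n).add_mem (hf.2 n) (hg.2 n)⟩
  smul_mem' c f hf := ⟨by simp [hf.1], fun n => by
    simpa [smul_sub] using (S n).smul_mem c (hf.2 n)⟩

/-- Finite-dimensional subspaces are closed, so membership of each increment in `S n` is a closed
condition. -/
lemma isClosed_partialSums (hS : IsFDD S) : IsClosed (partialSums S : Set C(OnePoint ℕ, F)) := by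
  have := hS.finiteDimensional
  have h : (partialSums S : Set C(OnePoint ℕ, F)) =
      {g | g ((0 : ℕ) : OnePoint ℕ) = 0} ∩
        ⋂ n : ℕ, {g | g ((n + 1 : ℕ) : OnePoint ℕ) - g (n : OnePoint ℕ) ∈ S n} := by
    ext g
    simp only [Set.mem_inter_iff, Set.mem_iInter]
    rfl
  rw [h]
  refine (isClosed_eq (continuous_eval_const _) continuous_const).inter
    (isClosed_iInter fun n => ?_)
  exact (S n).closed_of_finiteDimensional.preimage
    ((continuous_eval_const _).sub (continuous_eval_const _))

lemma partialSums_apply (g : C(OnePoint ℕ, F)) (hg : g ∈ partialSums S) (n : ℕ) :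
    ∑ i ∈ Finset.range n, (g ((i + 1 : ℕ) : OnePoint ℕ) - g (i : OnePoint ℕ)) =
      g (n : OnePoint ℕ) := by
  rw [Finset.sum_range_sub (fun i : ℕ => g (i : OnePoint ℕ)), hg.1, sub_zero]

lemma tendsto_apply_infty (g : C(OnePoint ℕ, F)) :
    Tendsto (fun n : ℕ => g (n : OnePoint ℕ)) atTop (𝓝 (g OnePoint.infty)) :=
  (OnePoint.continuous_iff_from_nat g).1 g.continuous

lemma coord_apply_infty (hS : IsFDD S) (g : C(OnePoint ℕ, F)) (hg : g ∈ partialSums S) :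
    hS.coord (g OnePoint.infty) =
      fun i : ℕ => g ((i + 1 : ℕ) : OnePoint ℕ) - g (i : OnePoint ℕ) := by
  refine hS.coord_eq_of_tendsto hg.2 ?_
  simp only [partialSums_apply g hg]
  exact tendsto_apply_infty g

/-- In a Banach space, the initial projections of a finite-dimensional decomposition are uniformly
bounded. -/
lemma exists_constantLE [CompleteSpace F] (hS : IsFDD S) : ∃ K, hS.ConstantLE K := by
  have : CompleteSpace (partialSums S) := hS.isClosed_partialSums.completeSpace_coe
  let ev : C(OnePoint ℕ, F) →L[𝕜] F := ContinuousMap.evalCLM 𝕜 OnePoint.infty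
  -- Taking the limit is a continuous bijection between Banach spaces, by existence and uniqueness
  -- of expansions. The open mapping theorem bounds its inverse, hence all partial sums at once.
  let φ : partialSums S →L[𝕜] F := ev.comp (partialSums S).subtypeL
  have hφ : ∀ g, φ g = g.1 OnePoint.infty := fun g => rfl
  have hval : ∀ (g : partialSums S) (n : ℕ),
      g.1 (n : OnePoint ℕ) = ∑ i ∈ Finset.range n, hS.coord (φ g) i := fun g n => by
    rw [hφ, hS.coord_apply_infty g.1 g.2, partialSums_apply g.1 g.2]
  have hinj : φ.ker = ⊥ := by
    refine LinearMap.ker_eq_bot'.2 fun g hg => ?_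
    replace hg : φ g = 0 := hg
    have h0 : hS.coord (0 : F) = 0 :=
      hS.coord_eq_of_tendsto (fun i => (S i).zero_mem) (by simp)
    ext x
    induction x using OnePoint.rec with
    | infty => exact hg
    | coe n => simp [hval, hg, h0]
  have hsurj : φ.range = ⊤ := by
    refine LinearMap.range_eq_top.2 fun x => ?_
    refine ⟨⟨OnePoint.continuousMapMkNat (fun n => ∑ i ∈ Finset.range n, hS.coord x i) x
      (hS.tendsto_sum_coord x), ?_, fun n => ?_⟩, rfl⟩
    · change ∑ i ∈ Finset.range 0, hS.coord x i = 0
      simp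
    · change ∑ i ∈ Finset.range (n + 1), hS.coord x i - ∑ i ∈ Finset.range n, hS.coord x i ∈ S n
      simpa [Finset.sum_range_succ] using hS.coord_mem x n
  let ψ := ContinuousLinearEquiv.ofBijective φ hinj hsurj
  refine ⟨‖(ψ.symm : F →L[𝕜] partialSums S)‖, fun n x => ?_⟩
  have hx : φ (ψ.symm x) = x := ψ.apply_symm_apply x
  have h := hval (ψ.symm x) (n + 1)
  rw [hx, ← proj_zero_left] at h
  rw [← h]
  exact ((ψ.symm x).1.norm_coe_le_norm _).trans ((ψ.symm : F →L[𝕜] partialSums S).le_opNorm x)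

end IsFDD

end FDD

/-! ### Strategies that meet countably many requirements -/

section Game

variable {F : Type*}

/-- The history of the first `n` moves of `x`, the last move first. -/
def hist (x : ℕ → F) (n : ℕ) : List F := ((List.range n).map x).reverse

@[simp] lemma hist_zero (x : ℕ → F) : hist x 0 = [] := rfl

lemma hist_succ (x : ℕ → F) (n : ℕ) : hist x (n + 1) = x n :: hist x n := by
  simp [hist, List.range_succ]

@[simp] lemma length_hist (x : ℕ → F) (n : ℕ) : (hist x n).length = n := by simp [hist]

lemma hist_eq_hist_iff {x y : ℕ → F} {n : ℕ} : hist x n = hist y n ↔ ∀ i < n, x i = y i := by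
  simp [hist]

lemma hist_update (x : ℕ → F) (n : ℕ) (y : F) :
    hist (Function.update x n y) (n + 1) = y :: hist x n := by
  rw [hist_succ, Function.update_self, List.cons_inj_right, hist_eq_hist_iff]
  exact fun i hi => Function.update_of_ne hi.ne _ _

lemma hist_add (x : ℕ → F) (p d : ℕ) :
    hist x (p + d) = hist (fun k => x (k + p)) d ++ hist x p := by
  induction d with
  | zero => rfl
  | succ d ih => rw [← Nat.add_assoc, hist_succ, ih, hist_succ, List.cons_append, Nat.add_comm p d]

lemma exists_hist_eq [Nonempty F] (r : List F) : ∃ x : ℕ → F, hist x r.length = r := by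
  induction r with
  | nil => exact ⟨fun _ => Classical.arbitrary F, rfl⟩
  | cons y r ih =>
    obtain ⟨x, hx⟩ := ih
    refine ⟨Function.update x r.length y, ?_⟩
    rw [List.length_cons, hist_update, hx]

/-- A well-founded plan for the second player: at a node, `y n` is the answer to the move `n` of
the first player and `t n` is the plan for the rest of the game. -/
inductive Plan (F : Type*)
  | leaf : Plan F
  | node (y : ℕ → F) (t : ℕ → Plan F) : Plan F

/-- From the position `r`, all plays according to the plan are legal and end in `B`. Here `L i n` is
the set of legal answers to the move `n` in a position of length `i`. -/
def Plan.Reaches (L : ℕ → ℕ → Set F) (B : Set (List F)) : Plan F → List F → Prop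
  | leaf, r => r ∈ B
  | node y t, r => ∀ n, y n ∈ L r.length n ∧ (t n).Reaches L B (y n :: r)

/-- The second player can force the game to reach `B` from the position `r`. -/
def Forces (L : ℕ → ℕ → Set F) (B : Set (List F)) (r : List F) : Prop :=
  ∃ t : Plan F, t.Reaches L B r

lemma Forces.of_mem {L : ℕ → ℕ → Set F} {B : Set (List F)} {r : List F} (h : r ∈ B) :
    Forces L B r :=
  ⟨.leaf, h⟩

/-- The contrapositive is the determinacy argument: at an unforced position some move of the first
player keeps every legal answer unforced. -/
lemma Forces.of_forall {L : ℕ → ℕ → Set F} {B : Set (List F)} {r : List F}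
    (h : ∀ n, ∃ y ∈ L r.length n, Forces L B (y :: r)) : Forces L B r := by
  choose y hy t ht using h
  exact ⟨.node y t, fun n => ⟨hy n, ht n⟩⟩

lemma Forces.mono {L : ℕ → ℕ → Set F} {B B' : Set (List F)} (h : B ⊆ B') {r : List F}
    (hr : Forces L B r) : Forces L B' r := by
  obtain ⟨t, ht⟩ := hr
  refine ⟨t, ?_⟩
  induction t generalizing r with
  | leaf => exact h ht
  | node y t ih => exact fun n => ⟨(ht n).1, ih n (ht n).2⟩

/-- `B` is forced if it contains all positions of length `N` whose moves satisfy conditions that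
can be met whatever the first player does. -/
lemma Forces.of_moves [Nonempty F] {L : ℕ → ℕ → Set F} {B : Set (List F)} (Q : ℕ → F → Prop)
    {p N : ℕ} (hpN : p ≤ N) (hQ : ∀ i, p ≤ i → i < N → ∀ n, ∃ y ∈ L i n, Q i y)
    (hB : ∀ x : ℕ → F, (∀ i, p ≤ i → i < N → Q i (x i)) → hist x N ∈ B)
    {r : List F} (hr : r.length = p) : Forces L B r := by
  have key : ∀ d i, i + d = N → p ≤ i → ∀ x : ℕ → F, (∀ k, p ≤ k → k < i → Q k (x k)) →
      Forces L B (hist x i) := by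
    intro d
    induction d with
    | zero =>
      rintro i rfl _ x hx
      exact .of_mem (hB x hx)
    | succ d ih =>
      intro i hi hpi x hx
      refine .of_forall fun n => ?_
      obtain ⟨y, hy, hQy⟩ := hQ i hpi (by omega) n
      refine ⟨y, by rwa [length_hist], ?_⟩
      rw [← hist_update]
      refine ih (i + 1) (by omega) (by omega) _ fun k hpk hk => ?_
      rcases Nat.lt_succ_iff_lt_or_eq.1 hk with hk | rfl
      · rw [Function.update_of_ne hk.ne]
        exact hx k hpk hk
      · rwa [Function.update_self]
  obtain ⟨x, hx⟩ := exists_hist_eq r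
  rw [← hx, hr]
  exact key (N - p) p (by omega) le_rfl x fun k h1 h2 => by omega

/-- A position of the second player who works on requirement `j`, begun at length `p`. -/
structure Pursuit (L : ℕ → ℕ → Set F) (B : ℕ → ℕ → Set (List F)) (r : List F) where
  j : ℕ
  p : ℕ
  y : ℕ → F
  t : ℕ → Plan F
  legal : ∀ n, y n ∈ L r.length n
  reaches : ∀ n, (t n).Reaches L (B j p) (y n :: r)

variable {L : ℕ → ℕ → Set F} {B : ℕ → ℕ → Set (List F)}

/-- A requirement begun at length p is never met at once, so its plan is not a leaf and prescribes a
move. -/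
lemma exists_pursuit (hB : ∀ j p, ∀ r ∈ B j p, r.length ≠ p)
    (hF : ∀ j r, Forces L (B j r.length) r) (j : ℕ) (r : List F) :
    ∃ P : Pursuit L B r, P.j = j := by
  obtain ⟨t, ht⟩ := hF j r
  cases t with
  | leaf => exact absurd rfl (hB _ _ _ ht)
  | node y t => exact ⟨⟨j, r.length, y, t, fun n => (ht n).1, fun n => (ht n).2⟩, rfl⟩

/-- Either the requirement is met and the next one is begun, or the play descends to a subplan.
After a move outside the plan any pursuit will do. -/
lemma Pursuit.exists_next (hB : ∀ j p, ∀ r ∈ B j p, r.length ≠ p)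
    (hF : ∀ j r, Forces L (B j r.length) r) {r : List F} (P : Pursuit L B r) (y : F) :
    ∃ Q : Pursuit L B (y :: r), y ∈ Set.range P.y → ∃ n,
      (y :: r ∈ B P.j P.p ∧ Q.j = P.j + 1) ∨ (Q.j = P.j ∧ P.t n = .node Q.y Q.t) := by
  by_cases hy : y ∈ Set.range P.y
  · obtain ⟨n, rfl⟩ := hy
    have hr := P.reaches n
    cases ht : P.t n with
    | leaf =>
      obtain ⟨Q, hQ⟩ := exists_pursuit hB hF (P.j + 1) (P.y n :: r)
      rw [ht] at hr
      exact ⟨Q, fun _ => ⟨n, .inl ⟨hr, hQ⟩⟩⟩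
    | node y' t' =>
      rw [ht] at hr
      exact ⟨⟨P.j, P.p, y', t', fun n => (hr n).1, fun n => (hr n).2⟩,
        fun _ => ⟨n, .inr ⟨rfl, ht⟩⟩⟩
  · obtain ⟨Q, -⟩ := exists_pursuit hB hF 0 (y :: r)
    exact ⟨Q, fun h => absurd h hy⟩

/-- If the second player can force every requirement from every position, then there is a strategy
all of whose plays meet all the requirements. -/
lemma exists_strategy (hB : ∀ j p, ∀ r ∈ B j p, r.length ≠ p)
    (hF : ∀ j r, Forces L (B j r.length) r) :
    ∃ Φ : List F → ℕ → F, (∀ r n, Φ r n ∈ L r.length n) ∧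
      ∀ x : ℕ → F, (∀ i, x i ∈ Set.range (Φ (hist x i))) →
        ∀ j, ∃ p n, hist x n ∈ B j p := by
  choose P₀ hP₀ using exists_pursuit hB hF 0
  choose next hnext using fun (r : List F) (P : Pursuit L B r) => P.exists_next hB hF
  let pos : ∀ r : List F, Pursuit L B r :=
    fun r => List.rec (P₀ []) (fun y r P => next r P y) r
  have hpos : ∀ y r, pos (y :: r) = next r (pos r) y := fun y r => rfl
  refine ⟨fun r => (pos r).y, fun r => (pos r).legal, fun x hx => ?_⟩
  have hstep : ∀ i, ∃ n,
      (hist x (i + 1) ∈ B (pos (hist x i)).j (pos (hist x i)).p ∧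
        (pos (hist x (i + 1))).j = (pos (hist x i)).j + 1) ∨
      ((pos (hist x (i + 1))).j = (pos (hist x i)).j ∧
        (pos (hist x i)).t n = .node (pos (hist x (i + 1))).y (pos (hist x (i + 1))).t) := by
    intro i
    rw [hist_succ, hpos]
    exact hnext _ _ _ (hx i)
  -- A play cannot descend forever in a well-founded plan, so the current requirement is met after
  -- finitely many moves.
  have hmeet : ∀ (s : Plan F) (i : ℕ), s = .node (pos (hist x i)).y (pos (hist x i)).t →
      ∃ i' p, hist x i' ∈ B (pos (hist x i)).j p ∧
        (pos (hist x i')).j = (pos (hist x i)).j + 1 := by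
    intro s
    induction s with
    | leaf =>
      intro i hi
      cases hi
    | node y t ih =>
      intro i hi
      injection hi with _ hit
      obtain ⟨n, ⟨h1, h2⟩ | ⟨h1, h2⟩⟩ := hstep i
      · exact ⟨i + 1, _, h1, h2⟩
      · obtain ⟨i', p, h⟩ := ih n (i + 1) (by rw [hit, h2])
        rw [h1] at h
        exact ⟨i', p, h⟩
  have hreach : ∀ j, ∃ i, (pos (hist x i)).j = j := by
    intro j
    induction j with
    | zero => exact ⟨0, hP₀ []⟩
    | succ j ih =>
      obtain ⟨i, rfl⟩ := ih
      obtain ⟨i', _, _, h⟩ := hmeet _ i rfl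
      exact ⟨i', h⟩
  intro j
  obtain ⟨i, rfl⟩ := hreach j
  obtain ⟨i', p, h, _⟩ := hmeet _ i rfl
  exact ⟨p, i', h⟩

/-- The tree of all finite plays in which the second player follows `Φ`. -/
def strategyTree (Φ : List F → ℕ → F) : Set (List F) :=
  {l | ∀ l' v, l' ++ [v] <+: l → v ∈ Set.range (Φ l'.reverse)}

lemma IsBranch.mem_range {Φ : List F → ℕ → F} {x : ℕ → F} (hx : IsBranch (strategyTree Φ) x)
    (n : ℕ) : x n ∈ Set.range (Φ (hist x n)) :=
  hx (n + 1) ((List.range n).map x) (x n) (by simp [List.range_succ])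

end Game

/-! ### The Δ-block tree of a strategy -/

section BlockTree

variable {𝕜 : Type*} [RCLike 𝕜] {F : Type*} [NormedAddCommGroup F] [NormedSpace 𝕜 F]
  {S : ℕ → Submodule 𝕜 F}

/-- The vectors of `S_E` that are supported by the interval `[a, b]` up to an error less than
`ε`. -/
def nearlySupported (hS : IsFDD S) (E : Submodule 𝕜 F) (ε : ℝ) (a b : ℕ) : Set F :=
  {y | y ∈ E ∧ ‖y‖ = 1 ∧ ‖y - hS.proj a b y‖ < ε}

/-- The legal answers to the move `n` in a position of length `i`. -/
def legalMoves (hS : IsFDD S) (E : Submodule 𝕜 F) (δ : ℕ → ℝ) (i n : ℕ) : Set F :=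
  {y | ∃ a b, n < a ∧ a ≤ b ∧ y ∈ nearlySupported hS E (δ i) a b}

lemma isBlockTree_strategyTree (hS : IsFDD S) (E : Submodule 𝕜 F) (δ : ℕ → ℝ)
    (Φ : List F → ℕ → F) (hΦ : ∀ r n, Φ r n ∈ legalMoves hS E δ r.length n) :
    IsBlockTree hS E δ (strategyTree Φ) where
  nonempty := ⟨[], fun l' v h => by simp at h⟩
  mem_sphere l hl v hv := by
    obtain ⟨s, t, rfl⟩ := List.append_of_mem hv
    obtain ⟨n, rfl⟩ := hl s v ⟨t, by simp⟩
    obtain ⟨a, b, -, -, h⟩ := hΦ s.reverse n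
    exact ⟨h.1, h.2.1⟩
  closed l hl l' h l'' v h' := hl l'' v (h'.trans h)
  successors l hl := by
    choose a b ha hab h using hΦ l.reverse
    refine ⟨Φ l.reverse, a, b, ?_, hab, fun i => by simpa using (h i).2.2,
      tendsto_atTop_mono (fun n => (ha n).le) tendsto_id⟩
    ext v
    refine ⟨fun hv => hv l v List.prefix_rfl, fun hv l' w hw => ?_⟩
    rcases List.prefix_concat_iff.1 hw with hw | hw
    · obtain ⟨rfl, hvw⟩ := List.append_inj' hw rfl
      obtain rfl : w = v := by simpa using hvw
      exact hv
    · exact hl l' w hw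

end BlockTree

/-! ### Finite nets and the separating sequence -/

section Nets

variable {𝕜 : Type*} [RCLike 𝕜] {F : Type*} [NormedAddCommGroup F] [NormedSpace 𝕜 F]
  {S : ℕ → Submodule 𝕜 F}

/-- The projections lie in a ball of radius 2K of a finite-dimensional space. An ε-net of them lifts
to vectors, and replacing two vectors by their projections adds 2ε. -/
lemma exists_finite_net {hS : IsFDD S} {K : ℝ} (hK : hS.ConstantLE K) (hK0 : 0 ≤ K)
    (E : Submodule 𝕜 F) {ε : ℝ} (hε : 0 < ε) (a b : ℕ) :
    ∃ N ⊆ nearlySupported hS E ε a b, N.Finite ∧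
      ∀ y ∈ nearlySupported hS E ε a b, ∃ y' ∈ N, ‖y - y'‖ < 3 * ε := by
  let V : Submodule 𝕜 F := ⨆ i ∈ Finset.Icc a b, S i
  have : FiniteDimensional 𝕜 V := hS.finiteDimensional_iSup a b
  have : ProperSpace V := FiniteDimensional.proper_rclike 𝕜 V
  have hcompact : IsCompact ((↑) '' Metric.closedBall (0 : V) (2 * K) : Set F) :=
    (isCompact_closedBall _ _).image continuous_subtype_val
  have htb : TotallyBounded (hS.proj a b '' nearlySupported hS E ε a b) := by
    refine hcompact.totallyBounded.subset ?_
    rintro _ ⟨y, hy, rfl⟩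
    refine ⟨⟨hS.proj a b y, hS.proj_mem_iSup a b y⟩, ?_, rfl⟩
    simpa [hy.2.1] using hK.norm_proj_le hK0 a b y
  obtain ⟨t, ht, htfin, hcover⟩ := Metric.finite_approx_of_totallyBounded htb ε hε
  obtain ⟨N, hN, hNfin, rfl⟩ := htfin.exists_subset_finite_image_eq ht
  refine ⟨N, hN, hNfin, fun y hy => ?_⟩
  have hy' := hcover ⟨y, hy, rfl⟩
  simp only [Set.mem_iUnion, Metric.mem_ball, dist_eq_norm, exists_prop, Set.exists_mem_image]
    at hy'
  obtain ⟨y', hy'N, hlt⟩ := hy'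
  refine ⟨y', hy'N, ?_⟩
  have h1 := hy.2.2
  have h2 := (hN hy'N).2.2
  have h3 : y - y' = (y - hS.proj a b y) + (hS.proj a b y - hS.proj a b y')
      - (y' - hS.proj a b y') := by abel
  rw [h3]
  linarith [norm_sub_le ((y - hS.proj a b y) + (hS.proj a b y - hS.proj a b y'))
    (y' - hS.proj a b y'), norm_add_le (y - hS.proj a b y) (hS.proj a b y - hS.proj a b y')]

/-- If `B` cannot be forced from `r₀`, then there is a sequence `m` such that all `Δ`-blocks
separated by `m` are approximated by plays that extend `r₀` and do not reach `B`. -/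
lemma exists_separating {hS : IsFDD S} {K : ℝ} (hK : hS.ConstantLE K) (hK0 : 0 ≤ K)
    (E : Submodule 𝕜 F) {δ : ℕ → ℝ} (hδ : ∀ i, 0 < δ i) {B : Set (List F)} {r₀ : List F}
    (hr₀ : ¬ Forces (legalMoves hS E δ) B r₀) :
    ∃ m : ℕ → ℕ, StrictMono m ∧ ∀ (x : ℕ → F) (a b : ℕ → ℕ), (∀ i, a i ≤ b i) →
      (∀ i, b i < a (i + 1)) → (∀ i, x i ∈ nearlySupported hS E (δ i) (a i) (b i)) →
      SeparatedBy m a b → ∃ x' : ℕ → F,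
        (∀ i, r₀.length ≤ i → x' i ∈ nearlySupported hS E (δ i) (a i) (b i)) ∧
        (∀ i, r₀.length ≤ i → ‖x i - x' i‖ < 3 * δ i) ∧
        ∀ n, r₀.length ≤ n → hist x' n ∉ B := by
  choose N hNsub hNfin hN using
    fun i a b => exists_finite_net hK hK0 E (hδ i) a b
  have hgood : ∀ r : List F, ∃ n, ¬ Forces (legalMoves hS E δ) B r →
      ∀ y ∈ legalMoves hS E δ r.length n, ¬ Forces (legalMoves hS E δ) B (y :: r) := by
    intro r
    by_contra! h
    exact (h 0).1 (.of_forall fun n => (h n).2)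
  choose g hg using hgood
  -- Only finitely many positions of length at most l beyond `r₀` use net points with indices up to
  -- l, so one number bounds the avoiding moves `g` at all of them.
  let U : ℕ → Set F := fun l => ⋃ i ∈ Set.Iic l, ⋃ a ∈ Set.Iic l, ⋃ b ∈ Set.Iic l, N i a b
  have hU : ∀ l, (U l).Finite := fun l =>
    (Set.finite_Iic l).biUnion fun i _ => (Set.finite_Iic l).biUnion fun a _ =>
      (Set.finite_Iic l).biUnion fun b _ => hNfin i a b
  have hbound : ∀ l, ∃ M, ∀ s : List F, s.length ≤ l → (∀ y ∈ s, y ∈ U l) → g (s ++ r₀) ≤ M := by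
    intro l
    have := (hU l).to_subtype
    have hfin := (List.finite_length_le (U l) l).image fun s => g (s.map Subtype.val ++ r₀)
    obtain ⟨M, hM⟩ := hfin.bddAbove
    refine ⟨M, fun s hs hsU => hM ⟨s.attach.map fun y => ⟨y.1, hsU y.1 y.2⟩, by simpa using hs, ?_⟩⟩
    simp [List.map_map, Function.comp_def]
  choose f hf using hbound
  -- If the intervals so far end below `m j`, the avoiding move is at most `f (m j)`, hence at most
  -- `m (j + 1)`, and the next interval lies beyond it. The value `m 0` serves the opening move when
  -- `r₀` is empty.
  let m : ℕ → ℕ := fun j => Nat.rec (g r₀) (fun _ k => max (k + 1) (f k)) j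
  have hm : ∀ j, m (j + 1) = max (m j + 1) (f (m j)) := fun j => rfl
  refine ⟨m, strictMono_nat_of_lt_succ fun j => by rw [hm]; omega,
    fun x a b hab hlt hx hsep => ?_⟩
  have hb : StrictMono b := strictMono_nat_of_lt_succ fun i => (hlt i).trans_le (hab _)
  choose w hwN hw using fun i => hN i (a i) (b i) (x i) (hx i)
  obtain ⟨x₀, hx₀⟩ := exists_hist_eq r₀
  set p := r₀.length with hp
  -- The head of x is overwritten by `r₀`, which is why only tails can be compared.
  let x' : ℕ → F := fun i => if i < p then x₀ i else w i
  have hx' : ∀ i, p ≤ i → x' i = w i := fun i hi => if_neg hi.not_gt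
  have hpre : hist x' p = r₀ := by
    rw [← hx₀, hist_eq_hist_iff]
    exact fun i hi => if_pos hi
  refine ⟨x', fun i hi => hx' i hi ▸ hNsub _ _ _ (hwN i), fun i hi => hx' i hi ▸ hw i, ?_⟩
  have key : ∀ d, ¬ Forces (legalMoves hS E δ) B (hist x' (p + d)) := by
    intro d
    induction d with
    | zero => rwa [Nat.add_zero, hpre]
    | succ d ih =>
      rw [← Nat.add_assoc, hist_succ]
      refine hg _ ih _ ?_
      rw [length_hist, hx' _ (Nat.le_add_right p d)]
      refine ⟨a (p + d), b (p + d), ?_, hab _, hNsub _ _ _ (hwN _)⟩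
      rcases Nat.eq_zero_or_eq_succ_pred (p + d) with h0 | hq
      · have hd : d = 0 := by omega
        have hp0 : p = 0 := by omega
        have h := hsep.1
        rw [hd, Nat.add_zero, hpre, hp0]
        exact h
      · obtain ⟨j, hj, hj'⟩ := hsep.2 (p + d).pred
        rw [show (p + d).pred + 1 = p + d from hq.symm] at hj'
        refine lt_of_le_of_lt ?_ hj'
        rw [hm]
        refine le_trans ?_ (le_max_right _ _)
        rw [hist_add, hpre]
        have hlast : (p + d).pred ≤ b (p + d).pred := hb.le_apply
        refine hf _ _ (by rw [length_hist]; omega) fun y hy => ?_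
        obtain ⟨k, hk, rfl⟩ : ∃ k < d, x' (k + p) = y := by simpa [hist] using hy
        have hbk : b (k + p) ≤ b (p + d).pred := hb.monotone (by omega)
        have hik : k + p ≤ b (k + p) := hb.le_apply
        have hak := hab (k + p)
        rw [hx' _ (by omega)]
        simp only [U, Set.mem_iUnion, Set.mem_Iic, exists_prop]
        exact ⟨k + p, by omega, a (k + p), by omega, b (k + p), by omega, hwN _⟩
  intro n hn hmem
  obtain ⟨d, rfl⟩ := Nat.exists_eq_add_of_le hn
  exact key d (.of_mem hmem)

end Nets

/-! ### Stability of domination under perturbation -/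

section Domination

variable {𝕜 : Type*} [RCLike 𝕜] {X Y : Type*} [NormedAddCommGroup X] [NormedSpace 𝕜 X]
  [NormedAddCommGroup Y] [NormedSpace 𝕜 Y]

variable (𝕜) in
/-- `∑ δ i * ‖c i‖` is controlled by the norm of `∑ c i • v i`, with the constant `D`. -/
def ControlsWith (δ : ℕ → ℝ) (D : ℝ) (v : ℕ → Y) : Prop :=
  ∀ (c : ℕ → 𝕜) (n : ℕ),
    ∑ i ∈ Finset.range n, δ i * ‖c i‖ ≤ D * ‖∑ i ∈ Finset.range n, c i • v i‖

variable (𝕜) in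
/-- `(x_i)_{i ≥ p} ≤^C (y_i)_{i ≥ p}`. -/
def TailDominatedWith (p : ℕ) (C : ℝ) (x : ℕ → X) (y : ℕ → Y) : Prop :=
  ∀ (c : ℕ → 𝕜) (n : ℕ), (∀ i < p, c i = 0) →
    ‖∑ i ∈ Finset.range n, c i • x i‖ ≤ C * ‖∑ i ∈ Finset.range n, c i • y i‖

lemma DominatedWith.mono {C C' : ℝ} {x : ℕ → X} {y : ℕ → Y} (h : DominatedWith 𝕜 C x y)
    (hC : C ≤ C') : DominatedWith 𝕜 C' x y :=
  fun c n => (h c n).trans (by gcongr)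

/-- The coefficients `c` with the first `p` of them replaced by zero. -/
def tailCoeff (p : ℕ) (c : ℕ → 𝕜) (i : ℕ) : 𝕜 := if i < p then 0 else c i

/-- As δ decreases, |c i| ≤ δ i |c i| / δ p for i < p. -/
lemma norm_sum_sub_sum_tailCoeff_le {δ : ℕ → ℝ} (hδ : IsPosNull δ) (p : ℕ) {z : ℕ → X}
    (hz : ∀ i, ‖z i‖ ≤ 1) (c : ℕ → 𝕜) (n : ℕ) :
    ‖∑ i ∈ Finset.range n, c i • z i - ∑ i ∈ Finset.range n, tailCoeff p c i • z i‖ ≤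
      (∑ i ∈ Finset.range n, δ i * ‖c i‖) / δ p := by
  rw [← Finset.sum_sub_distrib, Finset.sum_div]
  refine norm_sum_le_of_le _ fun i _ => ?_
  rw [← sub_smul, norm_smul, tailCoeff]
  have hp := hδ.pos p
  have hi := hδ.pos i
  split_ifs with h
  · rw [sub_zero, le_div_iff₀ hp, mul_comm (δ i), mul_assoc]
    have := hδ.antitone h.le
    gcongr
    nlinarith [hz i, norm_nonneg (z i)]
  · rw [sub_self, norm_zero, zero_mul]
    positivity

lemma norm_sum_tailCoeff_sub_le {δ : ℕ → ℝ} (hδ : IsPosNull δ) {p : ℕ} {z z' : ℕ → X}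
    (hz : ∀ i, p ≤ i → ‖z i - z' i‖ ≤ 3 * δ i) (c : ℕ → 𝕜) (n : ℕ) :
    ‖∑ i ∈ Finset.range n, tailCoeff p c i • z i -
      ∑ i ∈ Finset.range n, tailCoeff p c i • z' i‖ ≤
      3 * ∑ i ∈ Finset.range n, δ i * ‖c i‖ := by
  rw [← Finset.sum_sub_distrib, Finset.mul_sum]
  refine norm_sum_le_of_le _ fun i _ => ?_
  rw [← smul_sub, norm_smul, tailCoeff]
  have hi := hδ.pos i
  split_ifs with h
  · rw [norm_zero, zero_mul]
    positivity
  · nlinarith [hz i (not_lt.1 h), norm_nonneg (c i)]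

/-- Domination of tails is stable under perturbations of order `δ`, and passes to the full
sequences, if the dominating sequence controls `∑ δ i * ‖c i‖`. -/
lemma TailDominatedWith.dominatedWith {δ : ℕ → ℝ} (hδ : IsPosNull δ) {p : ℕ} {C D : ℝ}
    (hC : 0 ≤ C) {u u' : ℕ → X} {v v' : ℕ → Y} (hu : ∀ i, ‖u i‖ ≤ 1) (hv : ∀ i, ‖v i‖ ≤ 1)
    (huu' : ∀ i, p ≤ i → ‖u i - u' i‖ ≤ 3 * δ i) (hvv' : ∀ i, p ≤ i → ‖v i - v' i‖ ≤ 3 * δ i)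
    (hD : ControlsWith 𝕜 δ D v) (h : TailDominatedWith 𝕜 p C u' v') :
    DominatedWith 𝕜 (D / δ p + 3 * D + C * (1 + D / δ p + 3 * D)) u v := by
  -- In units of ‖∑ c i • v i‖, dropping the head costs D / δ p and the perturbation 3D. This is
  -- paid once for u and, multiplied by C, once for v.
  intro c n
  have h1 := norm_sum_sub_sum_tailCoeff_le hδ p hu c n
  have h2 := norm_sum_sub_sum_tailCoeff_le hδ p hv c n
  have h3 := norm_sum_tailCoeff_sub_le hδ huu' c n
  have h4 := norm_sum_tailCoeff_sub_le hδ hvv' c n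
  have h5 := h (tailCoeff p c) n fun i hi => if_pos hi
  have hA := hD c n
  have hA' := div_le_div_of_nonneg_right hA (hδ.pos p).le
  rw [mul_div_right_comm] at hA'
  rw [norm_sub_rev] at h2 h4
  have h6 := norm_le_norm_add_norm_sub' (∑ i ∈ Finset.range n, c i • u i)
    (∑ i ∈ Finset.range n, tailCoeff p c i • u i)
  have h7 := norm_le_norm_add_norm_sub' (∑ i ∈ Finset.range n, tailCoeff p c i • u i)
    (∑ i ∈ Finset.range n, tailCoeff p c i • u' i)
  have h8 := norm_le_norm_add_norm_sub' (∑ i ∈ Finset.range n, tailCoeff p c i • v i)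
    (∑ i ∈ Finset.range n, c i • v i)
  have h9 := norm_le_norm_add_norm_sub' (∑ i ∈ Finset.range n, tailCoeff p c i • v' i)
    (∑ i ∈ Finset.range n, tailCoeff p c i • v i)
  have h10 : C * ‖∑ i ∈ Finset.range n, tailCoeff p c i • v' i‖ ≤
      C * ((1 + D / δ p + 3 * D) * ‖∑ i ∈ Finset.range n, c i • v i‖) := by
    gcongr
    linarith
  linarith

end Domination

/-! ### Control by blocks for small Δ -/

section Blocks

variable {𝕜 : Type*} [RCLike 𝕜] {F : Type*} [NormedAddCommGroup F] [NormedSpace 𝕜 F]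
  {S : ℕ → Submodule 𝕜 F}

/-- If `∑ δ i < 1 / (2 K + 1)`, then `Δ`-blocks control `∑ δ i * ‖c i‖`. -/
lemma IsBlockWitness.controlsWith {hS : IsFDD S} {K : ℝ} (hK : hS.ConstantLE K) (hK0 : 0 ≤ K)
    {δ : ℕ → ℝ} (hδ : ∀ i, 0 ≤ δ i) (hsum : Summable δ) (hlt : (2 * K + 1) * ∑' i, δ i < 1)
    {x : ℕ → F} {a b : ℕ → ℕ} (hx : IsBlockWitness hS δ x a b) (hx1 : ∀ i, ‖x i‖ = 1) :
    ControlsWith 𝕜 δ ((∑' i, δ i) * (2 * K / (1 - (2 * K + 1) * ∑' i, δ i))) x := by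
  intro c n
  rcases Nat.eq_zero_or_pos n with rfl | hn
  · simp
  set s := ∑' i, δ i with hs
  have hs0 : 0 ≤ s := tsum_nonneg hδ
  -- The weighted sum is at most s times the largest |c k|, which the projection onto the k-th
  -- interval isolates.
  obtain ⟨k, hk, hmax⟩ := (Finset.range n).exists_max_image (fun i => ‖c i‖)
    ⟨0, Finset.mem_range.2 hn⟩
  set M := ‖c k‖ with hM
  have hM0 : 0 ≤ M := norm_nonneg _
  set u := ∑ i ∈ Finset.range n, c i • x i with hu
  set v := ∑ i ∈ Finset.range n, c i • hS.proj (a i) (b i) (x i) with hv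
  have hcs : ∑ i ∈ Finset.range n, δ i * ‖c i‖ ≤ s * M := by
    calc ∑ i ∈ Finset.range n, δ i * ‖c i‖ ≤ ∑ i ∈ Finset.range n, δ i * M :=
          Finset.sum_le_sum fun i hi => mul_le_mul_of_nonneg_left (hmax i hi) (hδ i)
      _ = (∑ i ∈ Finset.range n, δ i) * M := (Finset.sum_mul ..).symm
      _ ≤ s * M := by
          gcongr
          exact hsum.sum_le_tsum _ fun i _ => hδ i
  have huv : ‖v - u‖ ≤ s * M := by
    refine le_trans ?_ hcs
    rw [hu, hv, ← Finset.sum_sub_distrib]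
    refine norm_sum_le_of_le _ fun i _ => ?_
    rw [← smul_sub, norm_smul, mul_comm]
    exact mul_le_mul_of_nonneg_right (hx.close i).le (norm_nonneg _)
  have hb : StrictMono b := strictMono_nat_of_lt_succ fun i => (hx.lt i).trans_le (hx.nonempty _)
  have hdisj : ∀ i j, i < j → Disjoint (Finset.Icc (a i) (b i)) (Finset.Icc (a j) (b j)) := by
    intro i j hij
    rw [Finset.disjoint_left]
    intro l
    simp only [Finset.mem_Icc]
    obtain ⟨j, rfl⟩ := Nat.exists_eq_succ_of_ne_zero (Nat.ne_of_gt (Nat.zero_lt_of_lt hij))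
    have h1 := hx.lt j
    have h2 := hb.monotone (Nat.le_of_lt_succ hij)
    rw [Nat.succ_eq_add_one]
    omega
  have hproj : hS.proj (a k) (b k) v = c k • hS.proj (a k) (b k) (x k) := by
    rw [← IsFDD.projₗ_apply, hv, map_sum, Finset.sum_eq_single_of_mem k hk]
    · rw [map_smul, IsFDD.projₗ_apply, hS.proj_proj_of_subset _ subset_rfl]
    · intro i _ hik
      rw [map_smul, IsFDD.projₗ_apply, hS.proj_proj_of_disjoint, smul_zero]
      rcases lt_or_gt_of_ne hik with h | h
      · exact (hdisj i k h).symm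
      · exact hdisj k i h
  have h1 : M * (1 - δ k) ≤ 2 * K * ‖v‖ := by
    refine le_trans ?_ (hK.norm_proj_le hK0 (a k) (b k) v)
    rw [hproj, norm_smul]
    gcongr
    have := hx.close k
    rw [norm_sub_rev] at this
    linarith [norm_sub_norm_le (x k) (hS.proj (a k) (b k) (x k)), hx1 k]
  have hδk : δ k ≤ s := hsum.le_tsum k fun i _ => hδ i
  have h2 : ‖v‖ ≤ ‖u‖ + s * M := (norm_le_norm_add_norm_sub' v u).trans (by linarith)
  -- With δ k ≤ s, the inequality M(1 - δ k) ≤ 2K(‖u‖ + sM) is solved for M; the factor on the left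
  -- is positive by the smallness of Δ.
  have h3 : M * (1 - (2 * K + 1) * s) ≤ 2 * K * ‖u‖ := by
    have := mul_le_mul_of_nonneg_left h2 (by positivity : 0 ≤ 2 * K)
    have := mul_le_mul_of_nonneg_left hδk hM0
    linarith
  refine hcs.trans ?_
  rw [mul_assoc]
  gcongr
  rw [div_mul_eq_mul_div, le_div_iff₀ (by linarith)]
  exact h3

end Blocks

/-! ### Defeating a basis without control -/

section Far

variable {𝕜 : Type*} [RCLike 𝕜] {F : Type*} [NormedAddCommGroup F] [NormedSpace 𝕜 F]
  {S : ℕ → Submodule 𝕜 F}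

/-- A map from E to a finite-dimensional space has a nonzero kernel. -/
lemma exists_mem_proj_eq_zero (hS : IsFDD S) {E : Submodule 𝕜 F}
    (hE : ¬ FiniteDimensional 𝕜 E) (n : ℕ) : ∃ y ∈ E, ‖y‖ = 1 ∧ hS.proj 0 n y = 0 := by
  have hV := hS.finiteDimensional_iSup 0 n
  let f : E →ₗ[𝕜] (⨆ i ∈ Finset.Icc 0 n, S i : Submodule 𝕜 F) :=
    ((hS.projₗ 0 n).codRestrict _ (hS.proj_mem_iSup 0 n)).comp E.subtype
  obtain ⟨y, hy, hfy⟩ : ∃ y : E, y ≠ 0 ∧ f y = 0 := by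
    by_contra! h
    refine hE (FiniteDimensional.of_injective f ((injective_iff_map_eq_zero f).2 fun y hy => ?_))
    by_contra hne
    exact h y hne hy
  have hproj : hS.projₗ 0 n y = 0 := congrArg Subtype.val hfy
  have hy0 : (y : F) ≠ 0 := fun h => hy (Subtype.ext h)
  refine ⟨((‖(y : F)‖⁻¹ : ℝ) : 𝕜) • (y : F), E.smul_mem _ y.2, ?_, ?_⟩
  · rw [norm_smul, RCLike.norm_ofReal, abs_inv, abs_norm, inv_mul_cancel₀ (norm_ne_zero_iff.2 hy0)]
  · rw [← IsFDD.projₗ_apply, map_smul, hproj, smul_zero]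

/-- The unit sphere of `E` contains vectors which vanish on `[0, n]` and are nearly supported by a
finite interval. -/
lemma exists_mem_nearlySupported (hS : IsFDD S) {E : Submodule 𝕜 F}
    (hE : ¬ FiniteDimensional 𝕜 E) (n : ℕ) {ε : ℝ} (hε : 0 < ε) :
    ∃ b, n + 1 ≤ b ∧ ∃ y ∈ nearlySupported hS E ε (n + 1) b, hS.proj 0 n y = 0 := by
  obtain ⟨y, hyE, hy1, hy0⟩ := exists_mem_proj_eq_zero hS hE n
  have h : ∀ᶠ b in atTop, ‖hS.proj 0 b y - y‖ < ε := by
    have := (hS.tendsto_proj_zero y).eventually (Metric.ball_mem_nhds y hε)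
    simpa [dist_eq_norm] using this
  obtain ⟨b, hb, hnb⟩ := (h.and (eventually_ge_atTop (n + 1))).exists
  refine ⟨b, hnb, y, ⟨hyE, hy1, ?_⟩, hy0⟩
  rwa [norm_sub_rev, ← zero_add (hS.proj (n + 1) b y), ← hy0,
    hS.proj_zero_add_proj ((Nat.le_succ n).trans hnb)]

/-- The second player has legal moves at distance of order `δ i` in direction of a fixed vector
`z`, up to a perturbation that is far away. -/
lemma exists_legalMove {hS : IsFDD S} {K : ℝ} (hK : hS.ConstantLE K) (hK0 : 0 ≤ K)
    {E : Submodule 𝕜 F} (hE : ¬ FiniteDimensional 𝕜 E) {δ : ℕ → ℝ} (hδ : IsPosNull δ)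
    {z : F} (hzE : z ∈ E) (hz1 : ‖z‖ = 1) (q : ℕ) :
    ∃ θ > 0, ∀ (τ : 𝕜), ‖τ‖ = 1 → ∀ i n, ∃ y ∈ legalMoves hS E δ i n, ∃ r : ℝ,
      θ * δ i ≤ r ∧ hS.proj 0 q y = ((r : 𝕜) * τ) • hS.proj 0 q z := by
  have hδ0 := hδ.pos 0
  -- With t = δ i / M, the vector w = y + tτz has norm between 1/2 and 2 and is supported on [a, b]
  -- up to δ i / 4. Normalising at most doubles the error and leaves at least t / 2 of τz, whence θ
  -- = 1 / (2M).
  set M := 8 * (1 + 2 * K) + 2 * δ 0 with hM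
  have hM0 : 0 < M := by positivity
  refine ⟨1 / (2 * M), by positivity, fun τ hτ i n => ?_⟩
  have hδi := hδ.pos i
  have hδi0 := hδ.antitone (Nat.zero_le i)
  set t := δ i / M with ht
  have ht0 : 0 < t := by positivity
  have htM : t * M = δ i := div_mul_cancel₀ _ hM0.ne'
  have ht2 : t ≤ 1 / 2 := by
    rw [ht, div_le_iff₀ hM0]
    nlinarith
  have htK : t * (1 + 2 * K) ≤ δ i / 8 := by nlinarith
  -- Beyond n the vector is legal; beyond q it is invisible to P_[0,q], which then sees only the
  -- multiple of z.
  obtain ⟨b, hb, y, ⟨hyE, hy1, hyb⟩, hy0⟩ :=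
    exists_mem_nearlySupported hS hE (max n q) (ε := δ i / 8) (by positivity)
  set a := max n q + 1 with ha
  have hyq : hS.proj 0 q y = 0 := by
    rw [← hS.proj_proj_of_subset (c := 0) (d := max n q) y
      (Finset.Icc_subset_Icc le_rfl (le_max_right _ _)), hy0, ← IsFDD.projₗ_apply, map_zero]
  have htτ : ‖((t : 𝕜) * τ) • z‖ = t := by
    rw [norm_smul, norm_mul, hτ, hz1, RCLike.norm_ofReal, abs_of_pos ht0, mul_one, mul_one]
  set w := y + ((t : 𝕜) * τ) • z with hw
  have hρ1 : 1 / 2 ≤ ‖w‖ := by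
    have := norm_sub_le_norm_add y (((t : 𝕜) * τ) • z)
    rw [htτ, hy1] at this
    linarith
  have hρ2 : ‖w‖ ≤ 2 := by
    have := norm_add_le y (((t : 𝕜) * τ) • z)
    rw [htτ, hy1] at this
    linarith
  have hρ0 : 0 < ‖w‖ := by linarith
  have hnorm : ‖((‖w‖⁻¹ : ℝ) : 𝕜)‖ = ‖w‖⁻¹ := by rw [RCLike.norm_ofReal, abs_inv, abs_norm]
  refine ⟨((‖w‖⁻¹ : ℝ) : 𝕜) • w, ⟨a, b, by omega, hb, ?_, ?_, ?_⟩, t * ‖w‖⁻¹, ?_, ?_⟩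
  · exact E.smul_mem _ (E.add_mem hyE (E.smul_mem _ hzE))
  · rw [norm_smul, hnorm, inv_mul_cancel₀ hρ0.ne']
  · have hwb : ‖w - hS.proj a b w‖ ≤ δ i / 4 := by
      have h1 : w - hS.proj a b w = (y - hS.proj a b y) +
          (((t : 𝕜) * τ) • z - hS.proj a b (((t : 𝕜) * τ) • z)) := by
        simp only [← IsFDD.projₗ_apply, hw, map_add]
        abel
      have h2 := hK.norm_proj_le hK0 a b (((t : 𝕜) * τ) • z)
      rw [htτ] at h2
      have h3 := norm_sub_le (((t : 𝕜) * τ) • z) (hS.proj a b (((t : 𝕜) * τ) • z))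
      rw [htτ] at h3
      rw [h1]
      refine (norm_add_le _ _).trans ?_
      linarith
    rw [← IsFDD.projₗ_apply, map_smul, ← smul_sub, norm_smul, hnorm, IsFDD.projₗ_apply,
      inv_mul_lt_iff₀ hρ0]
    nlinarith
  · have h4 : 1 / 2 ≤ ‖w‖⁻¹ := by
      rw [one_div]
      exact inv_anti₀ hρ0 hρ2
    calc 1 / (2 * M) * δ i = t * (1 / 2) := by rw [ht]; field_simp
      _ ≤ t * ‖w‖⁻¹ := by gcongr
  · rw [← IsFDD.projₗ_apply, map_smul, hw, map_add, map_smul, IsFDD.projₗ_apply, hyq, zero_add,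
      smul_smul, IsFDD.projₗ_apply]
    push_cast
    congr 1
    ring

variable {Y : Type*} [NormedAddCommGroup Y] [NormedSpace 𝕜 Y]

lemma norm_coeff_le (e : SchauderBasis 𝕜 Y) (c : ℕ → 𝕜) {i n : ℕ} (hi : i < n) :
    ‖c i‖ ≤ ‖e.coord i‖ * ‖∑ j ∈ Finset.range n, c j • e j‖ := by
  have h : e.coord i (∑ j ∈ Finset.range n, c j • e j) = c i := by
    rw [map_sum, Finset.sum_eq_single_of_mem i (Finset.mem_range.2 hi)]
    · simp [e.ortho]
    · intro j _ hj
      simp [e.ortho, hj.symm]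
  rw [← h]
  exact (e.coord i).le_opNorm _

/-- If a Schauder basis does not control `∑ δ i * ‖c i‖`, then none of its tails does. -/
lemma exists_tail_of_not_controlsWith {δ : ℕ → ℝ} (hδ : IsPosNull δ) (e : SchauderBasis 𝕜 Y)
    (he : ∀ i, ‖e i‖ ≤ 1) (h : ∀ D, ¬ ControlsWith 𝕜 δ D e) (p : ℕ) (D : ℝ) (hD : 0 ≤ D) :
    ∃ (c : ℕ → 𝕜) (n : ℕ), p ≤ n ∧ (∀ i < p, c i = 0) ∧
      D * ‖∑ i ∈ Finset.range n, c i • e i‖ < ∑ i ∈ Finset.range n, δ i * ‖c i‖ := by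
  by_contra! hcon
  -- The coordinate functionals bound the head by H in units of A, so control by a tail would give
  -- control by the whole basis.
  set H := ∑ i ∈ Finset.range p, δ i * ‖e.coord i‖ with hH
  refine h (D * (1 + H / δ p) + H) fun c n => ?_
  have hp := hδ.pos p
  have hH0 : 0 ≤ H := Finset.sum_nonneg fun i _ => mul_nonneg (hδ.pos i).le (norm_nonneg _)
  set A := ‖∑ i ∈ Finset.range n, c i • e i‖ with hA
  have hhead : ∑ i ∈ Finset.range n, δ i * ‖(if i < p then c i else 0 : 𝕜)‖ ≤ H * A := by
    rw [hH, Finset.sum_mul]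
    calc ∑ i ∈ Finset.range n, δ i * ‖(if i < p then c i else 0 : 𝕜)‖
        = ∑ i ∈ (Finset.range n).filter (· < p), δ i * ‖c i‖ := by
          rw [Finset.sum_filter]
          exact Finset.sum_congr rfl fun i _ => by split_ifs <;> simp
      _ ≤ ∑ i ∈ (Finset.range n).filter (· < p), δ i * ‖e.coord i‖ * A := by
          refine Finset.sum_le_sum fun i hi => ?_
          rw [mul_assoc]
          exact mul_le_mul_of_nonneg_left
            (norm_coeff_le e c (Finset.mem_range.1 (Finset.mem_filter.1 hi).1)) (hδ.pos i).le
      _ ≤ ∑ i ∈ Finset.range p, δ i * ‖e.coord i‖ * A := by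
          refine Finset.sum_le_sum_of_subset_of_nonneg (fun i hi => ?_) fun i _ _ => ?_
          · exact Finset.mem_range.2 (Finset.mem_filter.1 hi).2
          · exact mul_nonneg (mul_nonneg (hδ.pos i).le (norm_nonneg _)) (norm_nonneg _)
  have hsplit : ∑ i ∈ Finset.range n, δ i * ‖c i‖ =
      ∑ i ∈ Finset.range n, δ i * ‖(if i < p then c i else 0 : 𝕜)‖ +
        ∑ i ∈ Finset.range n, δ i * ‖tailCoeff p c i‖ := by
    rw [← Finset.sum_add_distrib]
    exact Finset.sum_congr rfl fun i _ => by rw [tailCoeff]; split_ifs <;> simp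
  have hdiff : ‖∑ i ∈ Finset.range n, tailCoeff p c i • e i‖ ≤ (1 + H / δ p) * A := by
    have hle : ‖∑ i ∈ Finset.range n, (if i < p then c i else 0 : 𝕜) • e i‖ ≤ H / δ p * A := by
      rw [div_mul_eq_mul_div, le_div_iff₀ hp]
      refine le_trans ?_ hhead
      rw [mul_comm, ← le_div_iff₀' hp, Finset.sum_div]
      refine norm_sum_le_of_le _ fun i _ => ?_
      split_ifs with hi
      · rw [norm_smul, le_div_iff₀ hp, mul_comm (δ i), mul_assoc]
        have := hδ.antitone hi.le
        gcongr
        nlinarith [he i, norm_nonneg (e i)]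
      · simp
    have hs : ∑ i ∈ Finset.range n, tailCoeff p c i • e i =
        ∑ i ∈ Finset.range n, c i • e i -
          ∑ i ∈ Finset.range n, (if i < p then c i else 0 : 𝕜) • e i := by
      rw [← Finset.sum_sub_distrib]
      exact Finset.sum_congr rfl fun i _ => by rw [tailCoeff]; split_ifs <;> simp
    rw [hs]
    linarith [norm_sub_le (∑ i ∈ Finset.range n, c i • e i)
      (∑ i ∈ Finset.range n, (if i < p then c i else 0 : 𝕜) • e i)]
  have htail : ∑ i ∈ Finset.range n, δ i * ‖tailCoeff p c i‖ ≤
      D * ‖∑ i ∈ Finset.range n, tailCoeff p c i • e i‖ := by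
    rcases le_or_gt p n with hpn | hpn
    · exact hcon _ n hpn fun i hi => if_pos hi
    · have h0 : ∀ i ∈ Finset.range n, tailCoeff p c i = 0 := fun i hi =>
        if_pos ((Finset.mem_range.1 hi).trans hpn)
      rw [Finset.sum_eq_zero fun i hi => by rw [h0 i hi, norm_zero, mul_zero]]
      positivity
  have := mul_le_mul_of_nonneg_left hdiff hD
  rw [hsplit]
  linarith

/-- The positions in which `(x_i)_{i ≥ p} ≤^C (y_i)_{i ≥ p}` has failed. -/
def upperFailure (𝕜 : Type*) [RCLike 𝕜] {F Y : Type*} [NormedAddCommGroup F] [NormedSpace 𝕜 F]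
    [NormedAddCommGroup Y] [NormedSpace 𝕜 Y] (e : ℕ → Y) (C : ℝ) (p : ℕ) : Set (List F) :=
  {r | ∃ (x : ℕ → F) (n : ℕ) (c : ℕ → 𝕜), hist x n = r ∧ (∀ i < p, c i = 0) ∧
    C * ‖∑ i ∈ Finset.range n, c i • e i‖ < ‖∑ i ∈ Finset.range n, c i • x i‖}

/-- The positions in which `(y_i)_{i ≥ p} ≤^C (x_i)_{i ≥ p}` has failed. -/
def lowerFailure (𝕜 : Type*) [RCLike 𝕜] {F Y : Type*} [NormedAddCommGroup F] [NormedSpace 𝕜 F]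
    [NormedAddCommGroup Y] [NormedSpace 𝕜 Y] (e : ℕ → Y) (C : ℝ) (p : ℕ) : Set (List F) :=
  {r | ∃ (x : ℕ → F) (n : ℕ) (c : ℕ → 𝕜), hist x n = r ∧ (∀ i < p, c i = 0) ∧
    C * ‖∑ i ∈ Finset.range n, c i • x i‖ < ‖∑ i ∈ Finset.range n, c i • e i‖}

/-- The second player can prevent domination by a basis that does not control
`∑ δ i * ‖c i‖`. -/
lemma forces_upperFailure {hS : IsFDD S} {K : ℝ} (hK : hS.ConstantLE K) (hK0 : 0 ≤ K)
    {E : Submodule 𝕜 F} (hE : ¬ FiniteDimensional 𝕜 E) {δ : ℕ → ℝ} (hδ : IsPosNull δ)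
    (e : SchauderBasis 𝕜 Y) (he : ∀ i, ‖e i‖ ≤ 1) (h : ∀ D, ¬ ControlsWith 𝕜 δ D e)
    {C : ℝ} (hC : 0 ≤ C) (r : List F) :
    Forces (legalMoves hS E δ) (upperFailure 𝕜 e C r.length) r := by
  obtain ⟨z, hzE, hz1, -⟩ := exists_mem_proj_eq_zero hS hE 0
  have hz0 : z ≠ 0 := norm_ne_zero_iff.1 (by rw [hz1]; exact one_ne_zero)
  obtain ⟨q, hq⟩ := ((hS.tendsto_proj_zero z).eventually_ne hz0).exists
  have hw : 0 < ‖hS.proj 0 q z‖ := norm_pos_iff.2 hq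
  obtain ⟨θ, hθ, hmove⟩ := exists_legalMove hK hK0 hE hδ hzE hz1 q
  set p := r.length with hp
  -- The coefficients are fixed before the moves are made. The constant absorbs the bound K of
  -- P_[0,q] and the gain θ‖P_[0,q] z‖ of each move.
  obtain ⟨c, N, hpN, hc0, hc⟩ := exists_tail_of_not_controlsWith hδ e he h p
    (C * K / (θ * ‖hS.proj 0 q z‖)) (by positivity)
  -- The phases turn each c i into |c i|, so the contributions along z add up without cancellation.
  choose τ hτ hτc using fun i => RCLike.exists_norm_eq_mul_self (c i)
  refine .of_moves (fun i y => ∃ s : ℝ, θ * δ i ≤ s ∧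
    hS.proj 0 q y = ((s : 𝕜) * τ i) • hS.proj 0 q z) hpN
    (fun i _ _ n => hmove (τ i) (hτ i) i n) (fun x hx => ?_) rfl
  refine ⟨x, N, c, rfl, hc0, ?_⟩
  have hμ : ∀ i, ∃ μ : ℝ, i < N → θ * (δ i * ‖c i‖) ≤ μ ∧
      c i • hS.proj 0 q (x i) = (μ : 𝕜) • hS.proj 0 q z := by
    intro i
    rcases lt_or_ge i p with hip | hip
    · exact ⟨0, fun _ => by simp [hc0 i hip]⟩
    · by_cases hiN : i < N
      · obtain ⟨s, hs, hsy⟩ := hx i hip hiN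
        refine ⟨s * ‖c i‖, fun _ => ⟨?_, ?_⟩⟩
        · rw [← mul_assoc]
          gcongr
        · rw [hsy, smul_smul]
          rw [RCLike.ofReal_mul, show ((‖c i‖ : ℝ) : 𝕜) = τ i * c i from hτc i]
          congr 1
          ring
      · exact ⟨0, fun h => absurd h hiN⟩
  choose μ hμ using hμ
  have hproj : hS.proj 0 q (∑ i ∈ Finset.range N, c i • x i) =
      ((∑ i ∈ Finset.range N, μ i : ℝ) : 𝕜) • hS.proj 0 q z := by
    rw [← IsFDD.projₗ_apply, map_sum]
    push_cast
    rw [Finset.sum_smul]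
    refine Finset.sum_congr rfl fun i hi => ?_
    rw [map_smul, IsFDD.projₗ_apply, (hμ i (Finset.mem_range.1 hi)).2]
  have hμsum : θ * ∑ i ∈ Finset.range N, δ i * ‖c i‖ ≤ ∑ i ∈ Finset.range N, μ i := by
    rw [Finset.mul_sum]
    exact Finset.sum_le_sum fun i hi => (hμ i (Finset.mem_range.1 hi)).1
  have hle := hK q (∑ i ∈ Finset.range N, c i • x i)
  rw [hproj, norm_smul, RCLike.norm_ofReal] at hle
  refine lt_of_mul_lt_mul_left ?_ hK0
  refine lt_of_lt_of_le ?_ hle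
  rw [div_mul_eq_mul_div, div_lt_iff₀ (by positivity)] at hc
  calc K * (C * ‖∑ i ∈ Finset.range N, c i • e i‖)
      = C * K * ‖∑ i ∈ Finset.range N, c i • e i‖ := by ring
    _ < (∑ i ∈ Finset.range N, δ i * ‖c i‖) * (θ * ‖hS.proj 0 q z‖) := hc
    _ = (θ * ∑ i ∈ Finset.range N, δ i * ‖c i‖) * ‖hS.proj 0 q z‖ := by ring
    _ ≤ |∑ i ∈ Finset.range N, μ i| * ‖hS.proj 0 q z‖ := by
        gcongr
        exact hμsum.trans (le_abs_self _)

end Far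

/-! ### Forcing failures and the uniform estimate -/

section Main

variable {𝕜 : Type*} [RCLike 𝕜] {F : Type*} [NormedAddCommGroup F] [NormedSpace 𝕜 F]
  {S : ℕ → Submodule 𝕜 F} {Y : Type*} [NormedAddCommGroup Y] [NormedSpace 𝕜 Y]

/-- The positions in which the upper estimate (if `up`) or the lower estimate (if `lo`) with
constant `C` has failed for the tails beginning at `p`. -/
def failure (𝕜 : Type*) [RCLike 𝕜] {F Y : Type*} [NormedAddCommGroup F] [NormedSpace 𝕜 F]
    [NormedAddCommGroup Y] [NormedSpace 𝕜 Y] (up lo : Prop) (e : ℕ → Y) (C : ℝ) (p : ℕ) :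
    Set (List F) :=
  {r | (up ∧ r ∈ upperFailure 𝕜 e C p) ∨ (lo ∧ r ∈ lowerFailure 𝕜 e C p)}

lemma sum_hist_congr {x y : ℕ → F} {n : ℕ} (h : hist x n = hist y n) (c : ℕ → 𝕜) :
    ∑ i ∈ Finset.range n, c i • x i = ∑ i ∈ Finset.range n, c i • y i :=
  Finset.sum_congr rfl fun i hi => by rw [hist_eq_hist_iff.1 h i (Finset.mem_range.1 hi)]

lemma hist_mem_upperFailure_iff {e : ℕ → Y} {C : ℝ} {p : ℕ} {x : ℕ → F} {n : ℕ} :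
    hist x n ∈ upperFailure 𝕜 e C p ↔ ∃ c : ℕ → 𝕜, (∀ i < p, c i = 0) ∧
      C * ‖∑ i ∈ Finset.range n, c i • e i‖ < ‖∑ i ∈ Finset.range n, c i • x i‖ := by
  constructor
  · rintro ⟨y, m, c, hy, hc, hlt⟩
    obtain rfl : m = n := by simpa using congrArg List.length hy
    exact ⟨c, hc, by rwa [sum_hist_congr hy] at hlt⟩
  · rintro ⟨c, hc, hlt⟩
    exact ⟨x, n, c, rfl, hc, hlt⟩

lemma hist_mem_lowerFailure_iff {e : ℕ → Y} {C : ℝ} {p : ℕ} {x : ℕ → F} {n : ℕ} :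
    hist x n ∈ lowerFailure 𝕜 e C p ↔ ∃ c : ℕ → 𝕜, (∀ i < p, c i = 0) ∧
      C * ‖∑ i ∈ Finset.range n, c i • x i‖ < ‖∑ i ∈ Finset.range n, c i • e i‖ := by
  constructor
  · rintro ⟨y, m, c, hy, hc, hlt⟩
    obtain rfl : m = n := by simpa using congrArg List.length hy
    exact ⟨c, hc, by rwa [sum_hist_congr hy] at hlt⟩
  · rintro ⟨c, hc, hlt⟩
    exact ⟨x, n, c, rfl, hc, hlt⟩

/-- At length p all coefficients in play vanish, and failure would read 0 < 0. -/
lemma length_ne_of_mem_failure {up lo : Prop} {e : ℕ → Y} {C : ℝ} {p : ℕ} {r : List F}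
    (hr : r ∈ failure 𝕜 up lo e C p) : r.length ≠ p := by
  rintro rfl
  obtain ⟨x, hx⟩ := exists_hist_eq r
  have hzero : ∀ {c : ℕ → 𝕜}, (∀ i < r.length, c i = 0) →
      ∑ i ∈ Finset.range r.length, c i • x i = 0 ∧
        ∑ i ∈ Finset.range r.length, c i • e i = 0 := fun hc =>
    ⟨Finset.sum_eq_zero fun i hi => by rw [hc i (Finset.mem_range.1 hi), zero_smul],
      Finset.sum_eq_zero fun i hi => by rw [hc i (Finset.mem_range.1 hi), zero_smul]⟩
  rcases hr with ⟨-, h⟩ | ⟨-, h⟩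
  · rw [← congrArg (· ∈ upperFailure 𝕜 e C r.length) hx, hist_mem_upperFailure_iff] at h
    obtain ⟨c, hc, h⟩ := h
    simp [hzero hc] at h
  · rw [← congrArg (· ∈ lowerFailure 𝕜 e C r.length) hx, hist_mem_lowerFailure_iff] at h
    obtain ⟨c, hc, h⟩ := h
    simp [hzero hc] at h

/-- If no sequence `m` and no constant guarantee the estimates for the `Δ`-blocks separated by `m`,
then the second player can make the estimates with constant `C` fail. -/
lemma forces_failure {hS : IsFDD S} {K : ℝ} (hK : hS.ConstantLE K) (hK0 : 0 ≤ K)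
    {E : Submodule 𝕜 F} (hE : ¬ FiniteDimensional 𝕜 E) {δ : ℕ → ℝ} (hδ : IsPosNull δ)
    {up lo : Prop} {D : ℝ} (hlo : lo → ∀ (x : ℕ → F) (a b : ℕ → ℕ), IsBlockWitness hS δ x a b →
      (∀ i, ‖x i‖ = 1) → ControlsWith 𝕜 δ D x)
    (e : SchauderBasis 𝕜 Y) (he : ∀ i, ‖e i‖ = 1)
    (hbad : ∀ (C : ℝ) (m : ℕ → ℕ), StrictMono m → ∃ x, IsBlock hS E δ x ∧
      BlockSeparatedBy hS δ m x ∧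
        ¬ ((up → DominatedWith 𝕜 C x e) ∧ (lo → DominatedWith 𝕜 C e x)))
    {C : ℝ} (hC : 0 ≤ C) (r : List F) :
    Forces (legalMoves hS E δ) (failure 𝕜 up lo e C r.length) r := by
  by_cases hup : up ∧ ∀ D, ¬ ControlsWith 𝕜 δ D e
  · exact (forces_upperFailure hK hK0 hE hδ e (fun i => (he i).le) hup.2 hC r).mono
      fun s hs => .inl ⟨hup.1, hs⟩
  obtain ⟨D', hD'⟩ : ∃ D', up → ControlsWith 𝕜 δ D' e := by
    by_cases h : up
    · push Not at hup
      obtain ⟨D', hD'⟩ := hup h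
      exact ⟨D', fun _ => hD'⟩
    · exact ⟨0, fun h' => absurd h' h⟩
  by_contra hr
  obtain ⟨m, hm, hblock⟩ := exists_separating hK hK0 E hδ.pos hr
  set p := r.length with hp
  -- These are the constants that tail domination would give for the full sequences; `hbad` supplies
  -- a block violating their maximum.
  let C₁ := D' / δ p + 3 * D' + C * (1 + D' / δ p + 3 * D')
  let C₂ := D / δ p + 3 * D + C * (1 + D / δ p + 3 * D)
  obtain ⟨x, ⟨hxS, -⟩, ⟨a, b, hw, hsep⟩, hx⟩ := hbad (max C₁ C₂) m hm
  obtain ⟨x', hx'mem, hxx', hx'⟩ := hblock x a b hw.nonempty hw.lt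
    (fun i => ⟨(hxS i).1, (hxS i).2, by rw [norm_sub_rev]; exact hw.close i⟩) hsep
  have hzero : ∀ {n}, n < p → ∀ {c : ℕ → 𝕜}, (∀ i < p, c i = 0) →
      ∑ i ∈ Finset.range n, c i • x' i = 0 ∧ ∑ i ∈ Finset.range n, c i • e i = 0 :=
    fun hn _ hc =>
    ⟨Finset.sum_eq_zero fun i hi => by rw [hc i ((Finset.mem_range.1 hi).trans hn), zero_smul],
      Finset.sum_eq_zero fun i hi => by rw [hc i ((Finset.mem_range.1 hi).trans hn), zero_smul]⟩
  have hx1 : ∀ i, ‖x i‖ ≤ 1 := fun i => (hxS i).2.le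
  have he1 : ∀ i, ‖e i‖ ≤ 1 := fun i => (he i).le
  have hpert : ∀ i, p ≤ i → ‖x i - x' i‖ ≤ 3 * δ i := fun i hi => (hxx' i hi).le
  have hpert' : ∀ i, p ≤ i → ‖e i - e i‖ ≤ 3 * δ i := fun i _ => by
    rw [sub_self, norm_zero]
    linarith [hδ.pos i]
  refine hx ⟨fun h => ?_, fun h => ?_⟩
  · have htail : TailDominatedWith 𝕜 p C x' e := fun c n hc => by
      rcases lt_or_ge n p with hn | hn
      · simp [hzero hn hc]
      · by_contra! hlt
        exact hx' n hn (.inl ⟨h, hist_mem_upperFailure_iff.2 ⟨c, hc, hlt⟩⟩)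
    exact (htail.dominatedWith hδ hC hx1 he1 hpert hpert' (hD' h)).mono (le_max_left C₁ C₂)
  · have htail : TailDominatedWith 𝕜 p C e x' := fun c n hc => by
      rcases lt_or_ge n p with hn | hn
      · simp [hzero hn hc]
      · by_contra! hlt
        exact hx' n hn (.inr ⟨h, hist_mem_lowerFailure_iff.2 ⟨c, hc, hlt⟩⟩)
    exact (htail.dominatedWith hδ hC he1 hx1 hpert' hpert
      (hlo h x a b hw fun i => (hxS i).2)).mono (le_max_right C₁ C₂)

/-- If every `Δ`-block tree has a branch with the required estimates for one of countably many
bases, then these estimates hold with a uniform constant for one of the bases and all `Δ`-blocks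
separated by some sequence. -/
theorem exists_uniform_estimate {hS : IsFDD S} {K : ℝ} (hK : hS.ConstantLE K) (hK0 : 0 ≤ K)
    {E : Submodule 𝕜 F} (hE : ¬ FiniteDimensional 𝕜 E) {δ : ℕ → ℝ} (hδ : IsPosNull δ)
    {up lo : Prop} {D : ℝ} (hlo : lo → ∀ (x : ℕ → F) (a b : ℕ → ℕ), IsBlockWitness hS δ x a b →
      (∀ i, ‖x i‖ = 1) → ControlsWith 𝕜 δ D x)
    {ι : Type*} [Countable ι] (X : ι → Type*) [∀ k, NormedAddCommGroup (X k)]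
    [∀ k, NormedSpace 𝕜 (X k)] (e : ∀ k, SchauderBasis 𝕜 (X k)) (he : ∀ k i, ‖e k i‖ = 1)
    (htree : ∀ T : Set (List F), IsBlockTree hS E δ T → ∃ x : ℕ → F, IsBranch T x ∧
      ∃ k, (up → Dominated 𝕜 x (e k)) ∧ (lo → Dominated 𝕜 (e k) x)) :
    ∃ (C : ℝ) (k : ι) (m : ℕ → ℕ), StrictMono m ∧ ∀ x : ℕ → F, IsBlock hS E δ x →
      BlockSeparatedBy hS δ m x →
        (up → DominatedWith 𝕜 C x (e k)) ∧ (lo → DominatedWith 𝕜 C (e k) x) := by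
  by_contra! hbad
  -- The value `none` is a dummy requirement, met by any single move, so that an enumeration exists
  -- even when there are no bases.
  obtain ⟨g, hg⟩ := exists_surjective_nat (Option (ι × ℕ))
  let B : ℕ → ℕ → Set (List F) := fun j p =>
    match g j with
    | none => {r | r.length = p + 1}
    | some (k, C) => failure 𝕜 up lo (e k) C p
  have hB : ∀ j p, ∀ r ∈ B j p, r.length ≠ p := by
    intro j p r hr
    simp only [B] at hr
    split at hr
    · rw [Set.mem_ofPred_eq] at hr
      omega
    · exact length_ne_of_mem_failure hr
  have hF : ∀ j r, Forces (legalMoves hS E δ) (B j r.length) r := by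
    intro j r
    simp only [B]
    split
    · refine .of_forall fun n => ?_
      obtain ⟨b, hb, y, hy, -⟩ := exists_mem_nearlySupported hS hE n (hδ.pos r.length)
      exact ⟨y, ⟨n + 1, b, n.lt_succ_self, hb, hy⟩, .of_mem (by simp)⟩
    · rename_i k C _
      exact forces_failure hK hK0 hE hδ hlo (e k) (he k)
        (fun C m hm => by
          obtain ⟨x, h1, h2, h3⟩ := hbad C k m hm
          exact ⟨x, h1, h2, fun h => by tauto⟩) C.cast_nonneg r
  obtain ⟨Φ, hΦ, hplay⟩ := exists_strategy hB hF
  obtain ⟨x, hx, k, hup, hlow⟩ := htree _ (isBlockTree_strategyTree hS E δ Φ hΦ)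
  obtain ⟨C, hCup, hClo⟩ : ∃ C : ℕ, (up → DominatedWith 𝕜 C x (e k)) ∧
      (lo → DominatedWith 𝕜 C (e k) x) := by
    have h1 : ∃ C₁, up → DominatedWith 𝕜 C₁ x (e k) := by
      by_cases h : up
      · exact (hup h).imp fun _ h' _ => h'
      · exact ⟨0, fun h' => absurd h' h⟩
    have h2 : ∃ C₂, lo → DominatedWith 𝕜 C₂ (e k) x := by
      by_cases h : lo
      · exact (hlow h).imp fun _ h' _ => h'
      · exact ⟨0, fun h' => absurd h' h⟩
    obtain ⟨C₁, hC₁⟩ := h1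
    obtain ⟨C₂, hC₂⟩ := h2
    obtain ⟨C, hC⟩ := exists_nat_ge (max C₁ C₂)
    exact ⟨C, fun h => (hC₁ h).mono ((le_max_left _ _).trans hC),
      fun h => (hC₂ h).mono ((le_max_right _ _).trans hC)⟩
  obtain ⟨j, hj⟩ := hg (some (k, C))
  obtain ⟨p, n, hn⟩ := hplay x hx.mem_range j
  simp only [B, hj] at hn
  -- A failure on a tail is also a failure for the full sequence.
  rcases hn with ⟨h, hn⟩ | ⟨h, hn⟩
  · obtain ⟨c, -, hlt⟩ := hist_mem_upperFailure_iff.1 hn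
    exact hlt.not_ge (hCup h c n)
  · obtain ⟨c, -, hlt⟩ := hist_mem_lowerFailure_iff.1 hn
    exact hlt.not_ge (hClo h c n)

end Main

end AsymptoticGames

theorem mainTheorem10 {𝕜 : Type*} [RCLike 𝕜]
    {F : Type*} [NormedAddCommGroup F] [NormedSpace 𝕜 F] [CompleteSpace F]
    (S : ℕ → Submodule 𝕜 F) (hS : AsymptoticGames.IsFDD S)
    (E : Submodule 𝕜 F) (hEclosed : IsClosed (E : Set F)) (hEinf : ¬ FiniteDimensional 𝕜 E)
    (δ : ℕ → ℝ) (hδ : AsymptoticGames.IsPosNull δ)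
    {ι : Type*} [Countable ι] (X : ι → Type*) [∀ k, NormedAddCommGroup (X k)]
    [∀ k, NormedSpace 𝕜 (X k)] [∀ k, CompleteSpace (X k)]
    (e : ∀ k, SchauderBasis 𝕜 (X k)) (he : ∀ k i, ‖e k i‖ = 1) :
    ((∀ T : Set (List F), AsymptoticGames.IsBlockTree hS E δ T →
        ∃ x : ℕ → F, AsymptoticGames.IsBranch T x ∧
          ∃ k, AsymptoticGames.Dominated 𝕜 x (e k)) →
      ∃ (C : ℝ) (k : ι) (m : ℕ → ℕ), StrictMono m ∧
        ∀ x : ℕ → F, AsymptoticGames.IsBlock hS E δ x →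
          AsymptoticGames.BlockSeparatedBy hS δ m x →
          AsymptoticGames.DominatedWith 𝕜 C x (e k)) ∧
    (∀ K : ℝ, hS.ConstantLE K → Summable δ → (2 * K + 1) * ∑' i, δ i < 1 →
      ((∀ T : Set (List F), AsymptoticGames.IsBlockTree hS E δ T →
          ∃ x : ℕ → F, AsymptoticGames.IsBranch T x ∧
            ∃ k, AsymptoticGames.Dominated 𝕜 (e k) x) →
        ∃ (C : ℝ) (k : ι) (m : ℕ → ℕ), StrictMono m ∧
          ∀ x : ℕ → F, AsymptoticGames.IsBlock hS E δ x →
            AsymptoticGames.BlockSeparatedBy hS δ m x →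
            AsymptoticGames.DominatedWith 𝕜 C (e k) x) ∧
      ((∀ T : Set (List F), AsymptoticGames.IsBlockTree hS E δ T →
          ∃ x : ℕ → F, AsymptoticGames.IsBranch T x ∧
            ∃ k, AsymptoticGames.Dominated 𝕜 x (e k) ∧
              AsymptoticGames.Dominated 𝕜 (e k) x) →
        ∃ (C : ℝ) (k : ι) (m : ℕ → ℕ), StrictMono m ∧
          ∀ x : ℕ → F, AsymptoticGames.IsBlock hS E δ x →
            AsymptoticGames.BlockSeparatedBy hS δ m x →
            AsymptoticGames.DominatedWith 𝕜 C x (e k) ∧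
              AsymptoticGames.DominatedWith 𝕜 C (e k) x)) := by
  -- A nonzero vector serves only to show K ≥ 0.
  obtain ⟨z, -, hz, -⟩ := AsymptoticGames.exists_mem_proj_eq_zero hS hEinf 0
  have hz0 : z ≠ 0 := norm_ne_zero_iff.1 (by rw [hz]; exact one_ne_zero)
  refine ⟨fun htree => ?_, fun K hK hsum hlt => ?_⟩
  · obtain ⟨K, hK⟩ := hS.exists_constantLE
    obtain ⟨C, k, m, hm, h⟩ := AsymptoticGames.exists_uniform_estimate (up := True) (lo := False)
      (D := 0) hK (hK.nonneg hz0) hEinf hδ (fun h => h.elim) X e he fun T hT => by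
        obtain ⟨x, hx, k, hk⟩ := htree T hT
        exact ⟨x, hx, k, fun _ => hk, fun h => h.elim⟩
    exact ⟨C, k, m, hm, fun x hx hxm => (h x hx hxm).1 trivial⟩
  · have hK0 := hK.nonneg hz0
    have hcontrol := fun (x : ℕ → F) (a b : ℕ → ℕ)
      (hx : AsymptoticGames.IsBlockWitness hS δ x a b) =>
        hx.controlsWith hK hK0 (fun i => (hδ.pos i).le) hsum hlt
    refine ⟨fun htree => ?_, fun htree => ?_⟩
    · obtain ⟨C, k, m, hm, h⟩ := AsymptoticGames.exists_uniform_estimate (up := False)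
        (lo := True) hK hK0 hEinf hδ (fun _ => hcontrol) X e he fun T hT => by
          obtain ⟨x, hx, k, hk⟩ := htree T hT
          exact ⟨x, hx, k, fun h => h.elim, fun _ => hk⟩
      exact ⟨C, k, m, hm, fun x hx hxm => (h x hx hxm).2 trivial⟩
    · obtain ⟨C, k, m, hm, h⟩ := AsymptoticGames.exists_uniform_estimate (up := True)
        (lo := True) hK hK0 hEinf hδ (fun _ => hcontrol) X e he fun T hT => by
          obtain ⟨x, hx, k, hk, hk'⟩ := htree T hT
          exact ⟨x, hx, k, fun _ => hk, fun _ => hk'⟩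
      exact ⟨C, k, m, hm, fun x hx hxm => ⟨(h x hx hxm).1 trivial, (h x hx hxm).2 trivial⟩⟩
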